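/- For a permutation $\pi$ of $[n]=\{1,\dots,n\}$, write each cycle as $(c_1,c_2,\dots,c_k)$ with $c_1$ its smallest entry and $c_{m+1}=\pi(c_m)$. An entry $c_m$ with $2\le m\le k-1$ is a cyclic peak of $\pi$ if $c_{m-1}<c_m>c_{m+1}$ and a cyclic valley of $\pi$ if $c_{m-1}>c_m<c_{m+1}$. Let $\mathrm{cpk}(\pi)$, $\mathrm{cval}(\pi)$, $\mathrm{cyc}(\pi)$ and $\mathrm{fix}(\pi)$ be the numbers of cyclic peaks, cyclic valleys, cycles (fixed points included) and fixed points of $\pi$, and put $$P_n(q,x,y)=\sum_{\pi\in\mathfrak S_n}q^{\mathrm{cpk}(\pi)}x^{\mathrm{cyc}(\pi)}y^{\mathrm{fix}(\pi)},\qquad V_n(q,x,y)=\sum_{\pi\in\mathfrak S_n}q^{\mathrm{cval}(\pi)}x^{\mathrm{cyc}(\pi)}y^{\mathrm{fix}(\pi)}$$ for $n\ge 0$ (so $P_0=V_0=1$), and $$P(q,x,y,z)=\sum_{n\ge 0}P_n(q,x,y)\frac{z^n}{n!},\qquad V(q,x,y,z)=\sum_{n\ge 0}V_n(q,x,y)\frac{z^n}{n!}.$$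 Let $q\in\mathbb C\setminus\{0,1\}$. Then there is $\rho>0$, depending only on $q$, such that for all $x,y,z\in\mathbb C$ with $|z|<\rho$ both series converge and $$P(q,x,y,z)=e^{xz(y-1)}\biggl[\biggl(\frac{\sqrt{q}-1}{\sqrt{q}+1}\biggr)\biggl(\frac{\sqrt{q}+\cos(z\sqrt{q-1})+\sqrt{q-1}\,\sin(z\sqrt{q-1})}{\sqrt{q}-\cos(z\sqrt{q-1})-\sqrt{q-1}\,\sin(z\sqrt{q-1})}\biggr)\biggr]^{\frac{x}{2\sqrt{q}}},$$ $$V(q,x,y,z)=e^{xz(y-1/q)}\biggl(\frac{\sqrt{q-1}}{\sqrt{q-1}\,\cos(z\sqrt{q-1})-\sin(z\sqrt{q-1})}\biggr)^{\frac{x}{q}},$$ where $\sqrt q$ and $\sqrt{q-1}$ may be any complex square roots (the same one throughout each formula), and the complex powers are principal values (their bases equal $1$ at $z=0$). -/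

import Mathlib

/-- `i` is the smallest entry of the cycle of `σ` that contains it, i.e. the first entry of that
cycle in the standard cycle decomposition. -/
def IsCycleMin {n : ℕ} (σ : Equiv.Perm (Fin n)) (i : Fin n) : Prop :=
  ∀ j : Fin n, σ.SameCycle i j → i ≤ j

/-- `i` is a cyclic peak of `σ`. In the standard cycle decomposition each cycle is written
`(c₁, c₂, …, c_k)` with `c₁` its smallest entry and `c_{m+1} = σ c_m`. The entry `i = c_m` is
neither the first one (`i` is not the minimum of the cycle) nor the last one (`σ i` is not the
minimum of the cycle), so `2 ≤ m ≤ k - 1`, and `c_{m-1} < c_m > c_{m+1}`. -/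
def IsCyclicPeak {n : ℕ} (σ : Equiv.Perm (Fin n)) (i : Fin n) : Prop :=
  ¬ IsCycleMin σ i ∧ ¬ IsCycleMin σ (σ i) ∧ σ.symm i < i ∧ σ i < i

/-- `i` is a cyclic valley of `σ`: as for cyclic peaks, with `c_{m-1} > c_m < c_{m+1}`. -/
def IsCyclicValley {n : ℕ} (σ : Equiv.Perm (Fin n)) (i : Fin n) : Prop :=
  ¬ IsCycleMin σ i ∧ ¬ IsCycleMin σ (σ i) ∧ i < σ.symm i ∧ i < σ i

/-- The number of cyclic peaks. -/
noncomputable def cpk {n : ℕ} (σ : Equiv.Perm (Fin n)) : ℕ :=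
  Nat.card {i : Fin n // IsCyclicPeak σ i}

/-- The number of cyclic valleys. -/
noncomputable def cval {n : ℕ} (σ : Equiv.Perm (Fin n)) : ℕ :=
  Nat.card {i : Fin n // IsCyclicValley σ i}

/-- The number of cycles, fixed points (cycles of length one) included. -/
noncomputable def cyc {n : ℕ} (σ : Equiv.Perm (Fin n)) : ℕ :=
  Nat.card (Quotient (Equiv.Perm.SameCycle.setoid σ))

/-- The number of fixed points. -/
noncomputable def fixCount {n : ℕ} (σ : Equiv.Perm (Fin n)) : ℕ :=
  Nat.card {i : Fin n // σ i = i}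

/-- `P_n(q, x, y) = ∑ q^cpk x^cyc y^fix`, the sum over all permutations of an `n`-element chain. -/
noncomputable def peakPoly (n : ℕ) (q x y : ℂ) : ℂ :=
  ∑ σ : Equiv.Perm (Fin n), q ^ cpk σ * x ^ cyc σ * y ^ fixCount σ

/-- `V_n(q, x, y) = ∑ q^cval x^cyc y^fix`, the sum over all permutations of an `n`-element chain. -/
noncomputable def valleyPoly (n : ℕ) (q x y : ℂ) : ℂ :=
  ∑ σ : Equiv.Perm (Fin n), q ^ cval σ * x ^ cyc σ * y ^ fixCount σ

/-! Every permutation of `n + 1` entries arises once by inserting a new largest entry, either as a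
fixed point or inside an arc `i → σ i`. Give fixed points the weight `Y`, closing arcs `E`, arcs
touching a peak `W`, other arcs `T`, and each cycle `x`. Insertion into arcs then acts on the total
weight as a derivation, and a new fixed point multiplies by `x * Y` (`permWeight_insertMax_none`,
`prod_arcWeight_insertMax`). If `Y, E, W, T` are functions of `z` whose derivatives follow this
derivation and `I' = x * Y * I`, then the `n`-th derivative of `I` is `I` times the total weight
over `Fin n`. So `I` is the generating function of the weights taken at `z = 0`
(`hasSum_sum_permWeight`).

With `E = T = 1` and `W = r` at `0`, each peak has two arcs of weight `r` and contributes `r ^ 2 =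
q`. The system has explicit trigonometric solutions, and integrating `I' / I = x * Y` yields both
closed forms. Valleys are reduced to circular peaks, where closing arcs play no role, by
`cval_add_cyc`. -/

/-! ### Insertion of the largest entry and its effect on cycles. -/

/-- The permutation of `Fin (n + 1)` obtained from `σ` by inserting the new largest entry right
after `i` in the cycle of `i` (for `some i`), or as a new fixed point (for `none`). -/
def insertMax {n : ℕ} (σ : Equiv.Perm (Fin n)) (o : Option (Fin n)) : Equiv.Perm (Fin (n + 1)) :=
  (finSuccEquivLast.permCongr).symm (Equiv.Perm.decomposeOption.symm (o.map σ, σ))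

section insertMax

variable {n : ℕ} (σ : Equiv.Perm (Fin n))

@[simp] lemma insertMax_none_last : insertMax σ none (Fin.last n) = Fin.last n := by
  simp [insertMax, Equiv.permCongr_symm]

@[simp] lemma insertMax_none_castSucc (j : Fin n) :
    insertMax σ none j.castSucc = (σ j).castSucc := by
  simp [insertMax, Equiv.permCongr_symm]

@[simp] lemma insertMax_some_last (i : Fin n) :
    insertMax σ (some i) (Fin.last n) = (σ i).castSucc := by
  simp [insertMax, Equiv.permCongr_symm]

@[simp] lemma insertMax_some_self (i : Fin n) :
    insertMax σ (some i) i.castSucc = Fin.last n := by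
  simp [insertMax, Equiv.permCongr_symm]

lemma insertMax_some_of_ne {i j : Fin n} (h : j ≠ i) :
    insertMax σ (some i) j.castSucc = (σ j).castSucc := by
  have h1 : (some (σ j) : Option (Fin n)) ≠ some (σ i) := by simpa using h
  simp [insertMax, Equiv.permCongr_symm, Equiv.swap_apply_of_ne_of_ne, h1]

@[simp] lemma insertMax_none_symm_castSucc (j : Fin n) :
    (insertMax σ none).symm j.castSucc = (σ.symm j).castSucc := by
  simp [Equiv.symm_apply_eq]

@[simp] lemma insertMax_some_symm_last (i : Fin n) :
    (insertMax σ (some i)).symm (Fin.last n) = i.castSucc := by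
  simp [Equiv.symm_apply_eq]

@[simp] lemma insertMax_some_symm_self (i : Fin n) :
    (insertMax σ (some i)).symm (σ i).castSucc = Fin.last n := by
  simp [Equiv.symm_apply_eq]

lemma insertMax_some_symm_of_ne {i j : Fin n} (h : j ≠ σ i) :
    (insertMax σ (some i)).symm j.castSucc = (σ.symm j).castSucc := by
  rw [Equiv.symm_apply_eq, insertMax_some_of_ne σ (by rwa [ne_eq, Equiv.symm_apply_eq])]
  simp

/-- Every permutation of `Fin (n + 1)` arises in exactly one way by inserting the largest entry. -/
lemma sum_perm_succ (f : Equiv.Perm (Fin (n + 1)) → ℂ) :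
    ∑ τ, f τ = ∑ σ : Equiv.Perm (Fin n),
      (f (insertMax σ none) + ∑ i, f (insertMax σ (some i))) := by
  rw [← Equiv.sum_comp (finSuccEquivLast.permCongr).symm f,
    ← Equiv.sum_comp Equiv.Perm.decomposeOption.symm, Fintype.sum_prod_type_right]
  refine Finset.sum_congr rfl fun σ _ => ?_
  -- `decomposeOption` records the image of the new entry; reindexing by `σ` records its predecessor
  -- instead.
  rw [Fintype.sum_option, ← Equiv.sum_comp σ]
  rfl

lemma sameCycle_of_closed {α : Type*} [Finite α] {τ : Equiv.Perm α} {p : α → Prop}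
    (hp : ∀ a, p a → p (τ a)) {a b : α} (h : τ.SameCycle a b) (ha : p a) : p b := by
  obtain ⟨k, -, rfl⟩ := h.exists_pow_eq'
  induction k with
  | zero => simpa
  | succ k ih =>
    rw [pow_succ', Equiv.Perm.mul_apply]
    exact hp _ (ih ⟨k, by simp⟩)

lemma sameCycle_insertMax_castSucc (o : Option (Fin n)) {j k : Fin n} (h : σ.SameCycle j k) :
    (insertMax σ o).SameCycle j.castSucc k.castSucc := by
  refine sameCycle_of_closed (p := fun k => (insertMax σ o).SameCycle j.castSucc k.castSucc)
    (fun a ha => ?_) h (Equiv.Perm.SameCycle.refl _ _)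
  rcases o with _ | i
  · simpa using ha.apply_right
  · by_cases hai : a = i
    · subst hai
      have := ha.apply_right.apply_right
      simpa using this
    · have := ha.apply_right
      rwa [insertMax_some_of_ne σ hai] at this

/-- The invariant carried along the cycle treats the new entry as a copy of its predecessor. -/
lemma sameCycle_of_insertMax (o : Option (Fin n)) {j k : Fin n}
    (h : (insertMax σ o).SameCycle j.castSucc k.castSucc) : σ.SameCycle j k := by
  have key := sameCycle_of_closed
    (p := fun b => ∀ c, (b = Fin.castSucc c ∨ b = Fin.last n ∧ o = some c) → σ.SameCycle j c)
    (fun a ha c hc => ?_) h ?_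
  · exact key k (Or.inl rfl)
  · induction a using Fin.lastCases with
    | last =>
      rcases o with _ | i
      · simp only [reduceCtorEq, and_false, or_false, insertMax_none_last] at hc
        exact absurd hc.symm (Fin.castSucc_ne_last c)
      · have h1 := ha i (Or.inr ⟨rfl, rfl⟩)
        rcases hc with hc | ⟨hc, -⟩
        · rw [insertMax_some_last, Fin.castSucc_inj] at hc
          exact hc ▸ h1.apply_right
        · simp [Fin.castSucc_ne_last] at hc
    | cast a =>
      have h1 := ha a (Or.inl rfl)
      rcases o with _ | i
      · simp only [insertMax_none_castSucc, Fin.castSucc_inj, reduceCtorEq, and_false,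
          or_false] at hc
        exact hc ▸ h1.apply_right
      · by_cases hai : a = i
        · subst hai
          simp only [insertMax_some_self, true_and, Option.some.injEq] at hc
          rcases hc with hc | hc
          · exact absurd hc.symm (Fin.castSucc_ne_last c)
          · exact hc ▸ h1
        · rw [insertMax_some_of_ne σ hai] at hc
          simp only [Fin.castSucc_inj, Fin.castSucc_ne_last, false_and, or_false] at hc
          exact hc ▸ h1.apply_right
  · rintro c (hc | ⟨hc, -⟩)
    · rw [Fin.castSucc_inj] at hc
      exact hc ▸ Equiv.Perm.SameCycle.refl _ _
    · exact absurd hc (Fin.castSucc_ne_last j)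

@[simp] lemma isCycleMin_insertMax_castSucc (o : Option (Fin n)) (j : Fin n) :
    IsCycleMin (insertMax σ o) j.castSucc ↔ IsCycleMin σ j := by
  constructor
  · intro h k hk
    exact h k.castSucc (sameCycle_insertMax_castSucc σ o hk)
  · intro h k hk
    induction k using Fin.lastCases with
    | last => exact Fin.le_last _
    | cast k => exact h k (sameCycle_of_insertMax σ o hk)

@[simp] lemma not_isCycleMin_insertMax_last (i : Fin n) :
    ¬ IsCycleMin (insertMax σ (some i)) (Fin.last n) := by
  intro h
  have := h (σ i).castSucc (by
    simpa using (Equiv.Perm.SameCycle.refl (insertMax σ (some i)) (Fin.last n)).apply_right)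
  exact absurd this (not_le.2 (Fin.castSucc_lt_last _))

end insertMax

lemma isCycleMin_of_fixed {n : ℕ} {σ : Equiv.Perm (Fin n)} {i : Fin n} (h : σ i = i) :
    IsCycleMin σ i := by
  rintro j ⟨k, rfl⟩
  rw [Equiv.Perm.zpow_apply_eq_self_of_apply_eq_self h]

@[simp] lemma isCycleMin_insertMax_none_last {n : ℕ} (σ : Equiv.Perm (Fin n)) :
    IsCycleMin (insertMax σ none) (Fin.last n) :=
  isCycleMin_of_fixed (by simp)

lemma IsCycleMin.le_apply {n : ℕ} {σ : Equiv.Perm (Fin n)} {i : Fin n} (h : IsCycleMin σ i) :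
    i ≤ σ i :=
  h _ (Equiv.Perm.SameCycle.refl σ i).apply_right

lemma IsCycleMin.le_symm_apply {n : ℕ} {σ : Equiv.Perm (Fin n)} {i : Fin n}
    (h : IsCycleMin σ i) : i ≤ σ.symm i :=
  h _ (Equiv.Perm.SameCycle.refl σ i).symm_apply_right

/-! ### Peaks, arc weights and the insertion derivation. -/

/-- The arc from `i` to `σ i` closes its cycle, with a flag `b` that disregards closing arcs
when it is false. -/
def IsClosing (b : Prop) {n : ℕ} (σ : Equiv.Perm (Fin n)) (i : Fin n) : Prop :=
  b ∧ IsCycleMin σ (σ i)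

/-- Peaks in the circular sense, except that starts of closing arcs are not counted if `b`. -/
def IsPeak (b : Prop) {n : ℕ} (σ : Equiv.Perm (Fin n)) (i : Fin n) : Prop :=
  σ.symm i < i ∧ σ i < i ∧ ¬ IsClosing b σ i

lemma isCyclicPeak_iff {n : ℕ} (σ : Equiv.Perm (Fin n)) (i : Fin n) :
    IsCyclicPeak σ i ↔ IsPeak True σ i := by
  simp only [IsCyclicPeak, IsPeak, IsClosing, true_and]
  constructor
  · rintro ⟨-, h1, h2, h3⟩
    exact ⟨h2, h3, h1⟩
  · rintro ⟨h2, h3, h1⟩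
    exact ⟨fun h => absurd h.le_apply (not_le.2 h3), h1, h2, h3⟩

section peaks

variable {b : Prop} {n : ℕ} (σ : Equiv.Perm (Fin n))

@[simp] lemma isClosing_insertMax_last (i : Fin n) :
    IsClosing b (insertMax σ (some i)) (Fin.last n) ↔ IsClosing b σ i := by
  simp [IsClosing]

@[simp] lemma isClosing_insertMax_self (i : Fin n) :
    ¬ IsClosing b (insertMax σ (some i)) i.castSucc := by
  simp [IsClosing]

lemma isClosing_insertMax_of_ne {i j : Fin n} (h : j ≠ i) :
    IsClosing b (insertMax σ (some i)) j.castSucc ↔ IsClosing b σ j := by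
  simp [IsClosing, insertMax_some_of_ne σ h]

@[simp] lemma isClosing_insertMax_none (j : Fin n) :
    IsClosing b (insertMax σ none) j.castSucc ↔ IsClosing b σ j := by
  simp [IsClosing]

@[simp] lemma isPeak_insertMax_none (j : Fin n) :
    IsPeak b (insertMax σ none) j.castSucc ↔ IsPeak b σ j := by
  simp [IsPeak]

@[simp] lemma isPeak_insertMax_last (i : Fin n) :
    IsPeak b (insertMax σ (some i)) (Fin.last n) ↔ ¬ IsClosing b σ i := by
  simp [IsPeak, Fin.castSucc_lt_last]

lemma isPeak_insertMax_castSucc (i j : Fin n) :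
    IsPeak b (insertMax σ (some i)) j.castSucc ↔ IsPeak b σ j ∧ j ≠ i ∧ j ≠ σ i := by
  by_cases hji : j = i
  · subst hji
    simp [IsPeak, (Fin.castSucc_lt_last j).not_gt]
  by_cases hjs : j = σ i
  · subst hjs
    simp [IsPeak, (Fin.castSucc_lt_last (σ i)).not_gt]
  simp [IsPeak, isClosing_insertMax_of_ne σ hji, insertMax_some_of_ne σ hji,
    insertMax_some_symm_of_ne σ hjs, hji, hjs]

end peaks

open Classical in
/-- The weight of the arc from `i` to `σ i`. -/
noncomputable def arcWeight (b : Prop) (Y E W T : ℂ) {n : ℕ} (σ : Equiv.Perm (Fin n))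
    (i : Fin n) : ℂ :=
  if σ i = i then Y else if IsClosing b σ i then E else
    if IsPeak b σ i ∨ IsPeak b σ (σ i) then W else T

open Classical in
/-- The image of the arc weight under the derivation `Y ↦ E * T` (or `W ^ 2` if closing arcs are
disregarded), `E ↦ E * T`, `W ↦ W * T`, `T ↦ W ^ 2`. -/
noncomputable def arcDeriv (b : Prop) (E W T : ℂ) {n : ℕ} (σ : Equiv.Perm (Fin n))
    (i : Fin n) : ℂ :=
  if σ i = i then (if b then E * T else W ^ 2) else if IsClosing b σ i then E * T else
    if IsPeak b σ i ∨ IsPeak b σ (σ i) then W * T else W ^ 2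

open Classical in
/-- The weight of a permutation. -/
noncomputable def permWeight (b : Prop) (x Y E W T : ℂ) {n : ℕ} (σ : Equiv.Perm (Fin n)) : ℂ :=
  (∏ i, if IsCycleMin σ i then x else 1) * ∏ i, arcWeight b Y E W T σ i

section weights

variable {b : Prop} {x Y E W T : ℂ} {n : ℕ} (σ : Equiv.Perm (Fin n))

lemma permWeight_insertMax_none :
    permWeight b x Y E W T (insertMax σ none) = x * Y * permWeight b x Y E W T σ := by
  classical
  have h1 : ∀ j : Fin n, arcWeight b Y E W T (insertMax σ none) j.castSucc =
      arcWeight b Y E W T σ j := fun j => by simp [arcWeight]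
  have h2 : arcWeight b Y E W T (insertMax σ none) (Fin.last n) = Y := by simp [arcWeight]
  simp only [permWeight, Fin.prod_univ_castSucc, h1, h2, isCycleMin_insertMax_castSucc,
    isCycleMin_insertMax_none_last, if_true]
  ring

-- The new entry is a peak unless the split arc was closing. If it is a peak, both new arcs touch
-- it; otherwise the first touches no peak and the second closes the cycle.
open Classical in
lemma arcWeight_insertMax_last_mul_self (i : Fin n) :
    arcWeight b Y E W T (insertMax σ (some i)) i.castSucc *
      arcWeight b Y E W T (insertMax σ (some i)) (Fin.last n) =
    if IsClosing b σ i then E * T else W ^ 2 := by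
  have h0 : Fin.last n ≠ i.castSucc := (Fin.castSucc_ne_last i).symm
  by_cases h : IsClosing b σ i
  · simp [arcWeight, h, h0, isPeak_insertMax_castSucc, mul_comm, Fin.castSucc_ne_last]
  · simp [arcWeight, h, h0, sq, Fin.castSucc_ne_last]

open Classical in
lemma arcWeight_insertMax_of_ne {i j : Fin n} (h : j ≠ i) :
    arcWeight b Y E W T (insertMax σ (some i)) j.castSucc =
      if σ j = j then Y else if IsClosing b σ j then E else
        if (IsPeak b σ j ∧ j ≠ σ i) ∨ (IsPeak b σ (σ j) ∧ σ j ≠ i) then W else T := by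
  simp [arcWeight, insertMax_some_of_ne σ h, isClosing_insertMax_of_ne σ h,
    isPeak_insertMax_castSucc, h]

lemma arcWeight_insertMax_eq {i j : Fin n} (h : j ≠ i) (h1 : IsPeak b σ j → j ≠ σ i)
    (h2 : IsPeak b σ (σ j) → σ j ≠ i) :
    arcWeight b Y E W T (insertMax σ (some i)) j.castSucc = arcWeight b Y E W T σ j := by
  classical
  rw [arcWeight_insertMax_of_ne σ h, arcWeight]
  simp only [and_iff_left_of_imp h1, and_iff_left_of_imp h2]

lemma IsPeak.not_isPeak_apply {i : Fin n} (h : IsPeak b σ i) : ¬ IsPeak b σ (σ i) := by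
  intro h'
  have := h'.1
  rw [Equiv.symm_apply_apply] at this
  exact absurd this (not_lt.2 h.2.1.le)

/-- Cross-multiplied form of changing one factor, as the weights may vanish. -/
lemma prod_erase_change {i k : Fin n} (hk : k ≠ i) {f g : Fin n → ℂ} {u v : ℂ}
    (hf : f k = u) (hg : g k = v) (h : ∀ j, j ≠ i → j ≠ k → f j = g j) :
    v * ∏ j ∈ Finset.univ.erase i, f j = u * ∏ j ∈ Finset.univ.erase i, g j := by
  have hmem : k ∈ Finset.univ.erase i := by simp [hk]
  rw [← Finset.mul_prod_erase _ f hmem, ← Finset.mul_prod_erase _ g hmem, hf, hg,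
    Finset.prod_congr rfl fun j hj => h j ?_ ?_]
  · ring
  · simp only [Finset.mem_erase] at hj; exact hj.2.1
  · simp only [Finset.mem_erase] at hj; exact hj.1

/-- Splitting an arc next to a peak destroys that peak, so its other arc drops from `W` to `T` while
the split arc becomes `W ^ 2`. The net effect `W * W ↦ W ^ 2 * T` agrees with `W ↦ W * T` on the
split arc alone. In all other cases the remaining arcs keep their weights. -/
lemma prod_arcWeight_insertMax (i : Fin n) :
    ∏ j, arcWeight b Y E W T (insertMax σ (some i)) j =
      arcDeriv b E W T σ i * ∏ j ∈ Finset.univ.erase i, arcWeight b Y E W T σ j := by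
  classical
  rw [Fin.prod_univ_castSucc, ← Finset.mul_prod_erase _ _ (Finset.mem_univ i), mul_right_comm,
    arcWeight_insertMax_last_mul_self]
  by_cases hpi : IsPeak b σ i
  · have hfix : σ i ≠ i := hpi.2.1.ne
    have hne : σ.symm i ≠ i := hpi.1.ne
    have hnp := hpi.not_isPeak_apply
    have hnp' : ¬ IsPeak b σ (σ.symm i) := fun h => by
      have := h.not_isPeak_apply; rw [Equiv.apply_symm_apply] at this; exact this hpi
    have hncl : ¬ IsClosing b σ (σ.symm i) := fun h => by
      have := h.2; rw [Equiv.apply_symm_apply] at this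
      exact absurd this.le_apply (not_le.2 hpi.2.1)
    -- The other arc at the peak `i` is the one entering it.
    have key := prod_erase_change (i := i) (k := σ.symm i) (u := T) (v := W) hne
      (f := fun j => arcWeight b Y E W T (insertMax σ (some i)) j.castSucc)
      (g := fun j => arcWeight b Y E W T σ j)
      (by simp [arcWeight_insertMax_of_ne σ hne, hne.symm, hncl, hnp'])
      (by simp [arcWeight, hne.symm, hncl, hpi])
      (fun j hj hjk => by
        have h1 : σ j ≠ i := fun h => hjk (by rw [← h]; simp)
        have h2 : IsPeak b σ j → j ≠ σ i := fun h h' => hnp (h' ▸ h)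
        exact arcWeight_insertMax_eq σ hj h2 fun _ => h1)
    simp only [hpi.2.2, if_false, arcDeriv, hfix, hpi, true_or, if_true]
    linear_combination W * key
  by_cases hps : IsPeak b σ (σ i)
  · have hlt : i < σ i := by simpa using hps.1
    have hfix : σ i ≠ i := hlt.ne'
    have hnp := hps.not_isPeak_apply
    have hncl : ¬ IsClosing b σ i := fun h => absurd h.2.le_apply (not_le.2 hps.2.1)
    -- The other arc at the peak `σ i` is the one leaving it.
    have key := prod_erase_change (i := i) (k := σ i) (u := T) (v := W) hfix
      (f := fun j => arcWeight b Y E W T (insertMax σ (some i)) j.castSucc)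
      (g := fun j => arcWeight b Y E W T σ j)
      (by simp [arcWeight_insertMax_of_ne σ hfix, hfix, hps.2.2, hnp])
      (by simp [arcWeight, hfix, hps.2.2, hps])
      (fun j hj hjk => by
        have h2 : IsPeak b σ (σ j) → σ j ≠ i := fun h h' => hpi (h' ▸ h)
        exact arcWeight_insertMax_eq σ hj (fun _ => hjk) h2)
    simp only [hncl, if_false, arcDeriv, hfix, hps, or_true, if_true]
    linear_combination W * key
  · have hcongr : ∏ j ∈ Finset.univ.erase i,
        arcWeight b Y E W T (insertMax σ (some i)) j.castSucc =
        ∏ j ∈ Finset.univ.erase i, arcWeight b Y E W T σ j := by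
      refine Finset.prod_congr rfl fun j hj => ?_
      have h1 : IsPeak b σ j → j ≠ σ i := fun h h' => hps (h' ▸ h)
      have h2 : IsPeak b σ (σ j) → σ j ≠ i := fun h h' => hpi (h' ▸ h)
      exact arcWeight_insertMax_eq σ (Finset.ne_of_mem_erase hj) h1 h2
    rw [hcongr]
    congr 1
    by_cases hfix : σ i = i
    · have : IsClosing b σ i ↔ b := by
        simp [IsClosing, hfix, isCycleMin_of_fixed hfix]
      simp [arcDeriv, hfix, this]
    · simp [arcDeriv, hfix, hpi, hps]

open Classical in
lemma permWeight_insertMax_some (i : Fin n) :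
    permWeight b x Y E W T (insertMax σ (some i)) =
      (∏ j, if IsCycleMin σ j then x else 1) *
        (arcDeriv b E W T σ i * ∏ j ∈ Finset.univ.erase i, arcWeight b Y E W T σ j) := by
  simp [permWeight, prod_arcWeight_insertMax, Fin.prod_univ_castSucc (n := n)
    (fun j => if IsCycleMin (insertMax σ (some i)) j then x else 1)]

end weights

/-! ### From weights to the permutation statistics. -/

lemma prod_ite_one_eq_pow_card {α : Type*} [Fintype α] (p : α → Prop) [DecidablePred p] (x : ℂ) :
    (∏ i, if p i then x else 1) = x ^ Nat.card {i // p i} := by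
  rw [Finset.prod_ite, Finset.prod_const_one, mul_one, Finset.prod_const,
    Nat.card_eq_fintype_card, Fintype.card_subtype]

lemma cyc_eq_card_isCycleMin {n : ℕ} (σ : Equiv.Perm (Fin n)) :
    cyc σ = Nat.card {i : Fin n // IsCycleMin σ i} := by
  symm
  refine Nat.card_eq_of_bijective
    (fun i => (Quotient.mk (Equiv.Perm.SameCycle.setoid σ) i.1)) ⟨?_, ?_⟩
  · rintro ⟨i, hi⟩ ⟨j, hj⟩ h
    have h' : σ.SameCycle i j := Quotient.exact h
    exact Subtype.ext (le_antisymm (hi j h') (hj i h'.symm))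
  · intro a
    induction a using Quotient.inductionOn with
    | h i =>
      obtain ⟨m, hm, hmin⟩ := Set.exists_min_image {j | σ.SameCycle i j} id (Set.toFinite _)
        ⟨i, Equiv.Perm.SameCycle.refl σ i⟩
      exact ⟨⟨m, fun j hj => hmin j (hm.trans hj)⟩, Quotient.sound hm.symm⟩

lemma permWeight_one (b : Prop) (x y r : ℂ) {n : ℕ} (σ : Equiv.Perm (Fin n)) :
    permWeight b x y 1 r 1 σ =
      x ^ cyc σ * (y ^ fixCount σ * (r ^ 2) ^ Nat.card {i // IsPeak b σ i}) := by
  classical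
  have h : ∀ i, arcWeight b y 1 r 1 σ i = (if σ i = i then y else 1) *
      ((if IsPeak b σ i then r else 1) * if IsPeak b σ (σ i) then r else 1) := by
    intro i
    by_cases hfix : σ i = i
    · have : ¬ IsPeak b σ i := fun h => h.2.1.ne hfix
      simp [arcWeight, hfix, this]
    by_cases hcl : IsClosing b σ i
    · have h1 : ¬ IsPeak b σ i := fun h => h.2.2 hcl
      have h2 : ¬ IsPeak b σ (σ i) := fun h => absurd hcl.2.le_apply (not_le.2 h.2.1)
      simp [arcWeight, hfix, h1, h2]
    by_cases hpi : IsPeak b σ i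
    · simp [arcWeight, hfix, hcl, hpi, hpi.not_isPeak_apply]
    · simp [arcWeight, hfix, hcl, hpi]
  have h2 := Equiv.prod_comp σ (fun i => if IsPeak b σ i then r else 1)
  rw [permWeight]
  simp only [h, Finset.prod_mul_distrib]
  rw [h2, prod_ite_one_eq_pow_card, prod_ite_one_eq_pow_card, prod_ite_one_eq_pow_card,
    cyc_eq_card_isCycleMin, fixCount, ← pow_mul, two_mul, pow_add]

lemma card_subtype_add {α : Type*} [Finite α] {p q t : α → Prop}
    (hpq : ∀ a, p a → ¬ q a) (ht : ∀ a, t a ↔ p a ∨ q a) :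
    Nat.card {a // p a} + Nat.card {a // q a} = Nat.card {a // t a} := by
  classical
  have := Fintype.ofFinite α
  simp only [Nat.card_eq_fintype_card, Fintype.card_subtype]
  rw [← Finset.card_union_of_disjoint]
  · congr 1
    ext a
    simp [ht]
  · rw [Finset.disjoint_filter]
    exact fun a _ => hpq a

/-- Circularly there are as many peaks as valleys: removing double ascents leaves equinumerous sets,
by `h3`. A circular valley is either a cyclic valley or the minimum of a nontrivial cycle. -/
lemma cval_add_cyc {n : ℕ} (σ : Equiv.Perm (Fin n)) :
    cval σ + cyc σ = Nat.card {i // IsPeak False σ i} + fixCount σ := by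
  have hne : ∀ i, σ.symm i = i ↔ σ i = i := fun i => by
    rw [Equiv.symm_apply_eq, eq_comm]
  have h1 : Nat.card {i : Fin n // IsPeak False σ i} +
      Nat.card {i // σ.symm i < i ∧ i < σ i} = Nat.card {i // σ.symm i < i} := by
    refine card_subtype_add (fun i h h' => absurd h.2.1 h'.2.not_gt) fun i => ?_
    have := hne i
    simp only [IsPeak, IsClosing, false_and, not_false_iff, and_true]
    grind
  have h2 : Nat.card {i // i < σ.symm i ∧ i < σ i} +
      Nat.card {i // σ.symm i < i ∧ i < σ i} = Nat.card {i // i < σ i} := by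
    refine card_subtype_add (fun i h h' => absurd h.1 h'.1.not_gt) fun i => ?_
    have := hne i
    grind
  have h3 : Nat.card {i // i < σ i} = Nat.card {i // σ.symm i < i} :=
    Nat.card_congr (σ.subtypeEquiv fun i => by simp)
  have h4 : cval σ + Nat.card {i // IsCycleMin σ i ∧ σ i ≠ i} =
      Nat.card {i // i < σ.symm i ∧ i < σ i} := by
    refine card_subtype_add (fun i h h' => h.1 h'.1) fun i => ?_
    have := hne i
    constructor
    · intro h
      by_cases hm : IsCycleMin σ i
      · exact Or.inr ⟨hm, h.2.ne'⟩
      · exact Or.inl ⟨hm, fun h' => absurd h'.le_symm_apply (by simpa using h.2), h⟩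
    · rintro (h | ⟨h, h'⟩)
      · exact h.2.2
      · exact ⟨lt_of_le_of_ne h.le_symm_apply fun e => h' ((hne i).1 e.symm),
          lt_of_le_of_ne h.le_apply (Ne.symm h')⟩
  have h5 : fixCount σ + Nat.card {i // IsCycleMin σ i ∧ σ i ≠ i} = cyc σ := by
    rw [cyc_eq_card_isCycleMin]
    refine card_subtype_add (fun i h h' => h'.2 h) fun i => ?_
    have := isCycleMin_of_fixed (σ := σ) (i := i)
    tauto
  omega

lemma sum_permWeight_peak (n : ℕ) (x y r : ℂ) :
    ∑ σ : Equiv.Perm (Fin n), permWeight True x y 1 r 1 σ = peakPoly n (r ^ 2) x y := by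
  refine Finset.sum_congr rfl fun σ _ => ?_
  have : Nat.card {i // IsPeak True σ i} = cpk σ :=
    Nat.card_congr (Equiv.subtypeEquivRight fun i => (isCyclicPeak_iff σ i).symm)
  rw [permWeight_one, this]
  ring

/-- By `cval_add_cyc`, trading valleys for circular peaks costs a factor `1 / q` per cycle and `q`
per fixed point. -/
lemma sum_permWeight_valley (n : ℕ) (x y : ℂ) {r : ℂ} (hr : r ≠ 0) :
    ∑ σ : Equiv.Perm (Fin n), permWeight False (x / r ^ 2) (r ^ 2 * y) 1 r 1 σ =
      valleyPoly n (r ^ 2) x y := by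
  refine Finset.sum_congr rfl fun σ _ => ?_
  have hq : r ^ 2 ≠ 0 := pow_ne_zero 2 hr
  have h : (r ^ 2) ^ cval σ * (r ^ 2) ^ cyc σ =
      (r ^ 2) ^ Nat.card {i // IsPeak False σ i} * (r ^ 2) ^ fixCount σ := by
    rw [← pow_add, ← pow_add, cval_add_cyc]
  rw [permWeight_one, div_pow, mul_pow, div_mul_eq_mul_div, div_eq_iff (pow_ne_zero _ hq)]
  linear_combination -(x ^ cyc σ * y ^ fixCount σ) * h

/-! ### From the differential system to the power series. -/

/-- If the weights are functions that solve the system of differential equations given by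
insertion of the largest entry, so does the generating polynomial times `I`. -/
lemma hasDerivAt_sum_permWeight {b : Prop} [Decidable b] {x z : ℂ} {I Y E W T : ℂ → ℂ}
    (hI : HasDerivAt I (I z * (x * Y z)) z)
    (hY : HasDerivAt Y (if b then E z * T z else W z ^ 2) z)
    (hE : HasDerivAt E (E z * T z) z) (hW : HasDerivAt W (W z * T z) z)
    (hT : HasDerivAt T (W z ^ 2) z) (n : ℕ) :
    HasDerivAt (fun z => I z * ∑ σ : Equiv.Perm (Fin n),
        permWeight b x (Y z) (E z) (W z) (T z) σ)
      (I z * ∑ σ : Equiv.Perm (Fin (n + 1)), permWeight b x (Y z) (E z) (W z) (T z) σ) z := by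
  classical
  have harc : ∀ (σ : Equiv.Perm (Fin n)) (i : Fin n),
      HasDerivAt (fun z => arcWeight b (Y z) (E z) (W z) (T z) σ i)
        (arcDeriv b (E z) (W z) (T z) σ i) z := by
    intro σ i
    unfold arcWeight arcDeriv
    split_ifs <;> simp_all
  have hperm : ∀ σ : Equiv.Perm (Fin n),
      HasDerivAt (fun z => permWeight b x (Y z) (E z) (W z) (T z) σ)
        (∑ i, permWeight b x (Y z) (E z) (W z) (T z) (insertMax σ (some i))) z := by
    intro σ
    have := (HasDerivAt.fun_finsetProd (u := Finset.univ) fun i _ => harc σ i).const_mul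
      (∏ i, if IsCycleMin σ i then x else 1)
    unfold permWeight at this ⊢
    refine this.congr_deriv ?_
    rw [Finset.mul_sum]
    refine Finset.sum_congr rfl fun i _ => ?_
    rw [smul_eq_mul, mul_comm (∏ j ∈ _, _) (arcDeriv _ _ _ _ _ _)]
    exact (permWeight_insertMax_some σ i).symm
  have hsum := HasDerivAt.fun_sum (u := Finset.univ) fun σ _ => hperm σ
  refine (hI.mul hsum).congr_deriv ?_
  rw [sum_perm_succ, Finset.sum_add_distrib]
  simp only [permWeight_insertMax_none, ← Finset.mul_sum]
  ring

/-- On the disc `g n` is the `n`-th derivative of `g 0`, so this is the Taylor expansion of a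
holomorphic function. -/
lemma hasSum_of_hasDerivAt_succ {g : ℕ → ℂ → ℂ} {ρ : ℝ}
    (hg : ∀ n z, ‖z‖ < ρ → HasDerivAt (g n) (g (n + 1) z) z) {z : ℂ} (hz : ‖z‖ < ρ) :
    HasSum (fun n : ℕ => g n 0 * (z ^ n / (Nat.factorial n : ℂ))) (g 0 z) := by
  have hρ : 0 < ρ := (norm_nonneg z).trans_lt hz
  have key : ∀ n, Set.EqOn (iteratedDeriv n (g 0)) (g n) (Metric.ball 0 ρ) := by
    intro n
    induction n with
    | zero => intro w _; simp
    | succ n ih =>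
      intro w hw
      rw [iteratedDeriv_succ, (ih.eventuallyEq_of_mem (Metric.isOpen_ball.mem_nhds hw)).deriv_eq]
      exact (hg n w (by simpa using hw)).deriv
  have h := Complex.hasSum_taylorSeries_on_ball (f := g 0) (c := 0) (r := ρ) (z := z)
    (fun w hw => (hg 0 w (by simpa using hw)).differentiableAt.differentiableWithinAt)
    (by simpa using hz)
  have hterm : (fun n : ℕ => g n 0 * (z ^ n / (Nat.factorial n : ℂ))) = fun n : ℕ =>
      (Nat.factorial n : ℂ)⁻¹ • (z - 0) ^ n • iteratedDeriv n (g 0) 0 := by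
    funext n
    rw [key n (Metric.mem_ball_self hρ), sub_zero, smul_eq_mul, smul_eq_mul]
    ring
  rw [hterm]
  exact h

lemma hasSum_sum_permWeight {b : Prop} [Decidable b] {x : ℂ} {I Y E W T : ℂ → ℂ} {ρ : ℝ}
    (hI : ∀ z, ‖z‖ < ρ → HasDerivAt I (I z * (x * Y z)) z)
    (hY : ∀ z, ‖z‖ < ρ → HasDerivAt Y (if b then E z * T z else W z ^ 2) z)
    (hE : ∀ z, ‖z‖ < ρ → HasDerivAt E (E z * T z) z)
    (hW : ∀ z, ‖z‖ < ρ → HasDerivAt W (W z * T z) z)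
    (hT : ∀ z, ‖z‖ < ρ → HasDerivAt T (W z ^ 2) z) {z : ℂ} (hz : ‖z‖ < ρ) :
    HasSum (fun n : ℕ => I 0 * (∑ σ : Equiv.Perm (Fin n),
      permWeight b x (Y 0) (E 0) (W 0) (T 0) σ) * (z ^ n / (Nat.factorial n : ℂ))) (I z) := by
  have h := hasSum_of_hasDerivAt_succ (g := fun n z => I z * ∑ σ : Equiv.Perm (Fin n),
      permWeight b x (Y z) (E z) (W z) (T z) σ) (fun n z hz =>
    hasDerivAt_sum_permWeight (hI z hz) (hY z hz) (hE z hz) (hW z hz) (hT z hz) n) hz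
  have h0 : I z * ∑ σ : Equiv.Perm (Fin 0), permWeight b x (Y z) (E z) (W z) (T z) σ = I z := by
    simp [permWeight]
  rwa [h0] at h

/-! ### Trigonometric solutions and the closed forms. -/

section closedForm

variable {r s : ℂ}

/-- The points near which both closed forms are analytic. -/
structure IsRegularPoint (r s z : ℂ) : Prop where
  denom_ne : s * Complex.cos (z * s) - Complex.sin (z * s) ≠ 0
  valley_mem : s / (s * Complex.cos (z * s) - Complex.sin (z * s)) ∈ Complex.slitPlane
  peak_mem : ((r - 1) / (r + 1)) * ((r + Complex.cos (z * s) + s * Complex.sin (z * s)) /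
    (r - Complex.cos (z * s) - s * Complex.sin (z * s))) ∈ Complex.slitPlane

lemma eventually_isRegularPoint (hs : s ≠ 0) (hr1 : r - 1 ≠ 0) (hr2 : r + 1 ≠ 0) :
    ∀ᶠ z in nhds 0, IsRegularPoint r s z := by
  have h1 : ContinuousAt (fun z => s * Complex.cos (z * s) - Complex.sin (z * s)) 0 := by fun_prop
  have h2 : ContinuousAt (fun z => s / (s * Complex.cos (z * s) - Complex.sin (z * s))) 0 :=
    continuousAt_const.div h1 (by simpa using hs)
  have h3 : ContinuousAt (fun z => ((r - 1) / (r + 1)) *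
      ((r + Complex.cos (z * s) + s * Complex.sin (z * s)) /
        (r - Complex.cos (z * s) - s * Complex.sin (z * s)))) 0 :=
    continuousAt_const.mul (ContinuousAt.div (by fun_prop) (by fun_prop) (by simpa using hr1))
  have h4 : (r - 1) / (r + 1) * ((r + 1) / (r - 1)) = 1 := by field_simp
  filter_upwards [h1.eventually_ne (y := 0) (by simpa using hs),
    h2.eventually_mem (Complex.isOpen_slitPlane.mem_nhds (by simp [hs])),
    h3.eventually_mem (Complex.isOpen_slitPlane.mem_nhds (by simp [h4]))] with z a b c
  exact ⟨a, b, c⟩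

/-- There are only finitely many pairs of roots, so one disc serves them all and depends on `q`
alone. -/
lemma exists_radius {q : ℂ} (hq1 : q ≠ 1) :
    ∃ ρ : ℝ, 0 < ρ ∧ ∀ r s : ℂ, r ^ 2 = q → s ^ 2 = q - 1 → ∀ z : ℂ, ‖z‖ < ρ →
      IsRegularPoint r s z := by
  have hfin : {p : ℂ × ℂ | p.1 ^ 2 = q ∧ p.2 ^ 2 = q - 1}.Finite := by
    have h : ∀ a : ℂ, {w : ℂ | w ^ 2 = a}.Finite := fun a => by
      obtain ⟨w₀, hw₀⟩ := IsAlgClosed.exists_pow_nat_eq a (n := 2) two_pos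
      refine (Set.toFinite {w₀, -w₀}).subset fun w hw => ?_
      exact sq_eq_sq_iff_eq_or_eq_neg.1 ((show w ^ 2 = a from hw).trans hw₀.symm)
    exact (h q).prod (h (q - 1))
  have hev : ∀ᶠ z in nhds (0 : ℂ), ∀ p ∈ {p : ℂ × ℂ | p.1 ^ 2 = q ∧ p.2 ^ 2 = q - 1},
      IsRegularPoint p.1 p.2 z := by
    rw [Filter.eventually_all_finite hfin]
    rintro ⟨r, s⟩ ⟨hr, hs⟩
    simp only at hr hs
    refine eventually_isRegularPoint ?_ ?_ ?_
    · rintro rfl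
      exact hq1 (by linear_combination -hs)
    · intro h
      exact hq1 (by linear_combination (r + 1) * h - hr)
    · intro h
      exact hq1 (by linear_combination (r - 1) * h - hr)
  obtain ⟨ρ, hρ, h⟩ := Metric.eventually_nhds_iff.1 hev
  exact ⟨ρ, hρ, fun r s hr hs z hz => h (by simpa using hz) (r, s) ⟨hr, hs⟩⟩

lemma hasDerivAt_denom (s z : ℂ) :
    HasDerivAt (fun z => s * Complex.cos (z * s) - Complex.sin (z * s))
      (-(s * (Complex.cos (z * s) + s * Complex.sin (z * s)))) z := by
  have h : HasDerivAt (fun z : ℂ => z * s) s z := by simpa using (hasDerivAt_id z).mul_const s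
  exact ((h.ccos.const_mul s).sub h.csin).congr_deriv (by ring)

lemma hasDerivAt_numer (s z : ℂ) :
    HasDerivAt (fun z => Complex.cos (z * s) + s * Complex.sin (z * s))
      (s * (s * Complex.cos (z * s) - Complex.sin (z * s))) z := by
  have h : HasDerivAt (fun z : ℂ => z * s) s z := by simpa using (hasDerivAt_id z).mul_const s
  exact (h.ccos.add (h.csin.const_mul s)).congr_deriv (by ring)

/-- Denominator `D` and numerator `N` satisfy `D' = -s * N` and `N' = s * D`, so `D ^ 2 + N ^ 2` is
conserved. -/
lemma denom_sq_add_numer_sq (hrs : r ^ 2 = s ^ 2 + 1) (z : ℂ) :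
    (s * Complex.cos (z * s) - Complex.sin (z * s)) ^ 2 +
      (Complex.cos (z * s) + s * Complex.sin (z * s)) ^ 2 = r ^ 2 := by
  linear_combination (s ^ 2 + 1) * Complex.sin_sq_add_cos_sq (z * s) - hrs

/-- The solution `L` of `L' = L * T`, `T' = r ^ 2 * L ^ 2` with `L 0 = T 0 = 1`. -/
noncomputable def solL (s z : ℂ) : ℂ := s / (s * Complex.cos (z * s) - Complex.sin (z * s))

/-- The solution `T` of `L' = L * T`, `T' = r ^ 2 * L ^ 2` with `L 0 = T 0 = 1`. -/
noncomputable def solT (s z : ℂ) : ℂ := s * (Complex.cos (z * s) + s * Complex.sin (z * s)) /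
  (s * Complex.cos (z * s) - Complex.sin (z * s))

lemma hasDerivAt_solL {z : ℂ} (h : s * Complex.cos (z * s) - Complex.sin (z * s) ≠ 0) :
    HasDerivAt (solL s) (solL s z * solT s z) z := by
  refine ((hasDerivAt_const z s).div (hasDerivAt_denom s z) h).congr_deriv ?_
  simp only [solL, solT]
  field_simp
  ring

lemma hasDerivAt_solT (hrs : r ^ 2 = s ^ 2 + 1) {z : ℂ}
    (h : s * Complex.cos (z * s) - Complex.sin (z * s) ≠ 0) :
    HasDerivAt (solT s) ((r * solL s z) ^ 2) z := by
  refine (((hasDerivAt_numer s z).const_mul s).div (hasDerivAt_denom s z) h).congr_deriv ?_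
  have h1 := denom_sq_add_numer_sq hrs z
  simp only [solL]
  generalize s * Complex.cos (z * s) - Complex.sin (z * s) = D at *
  generalize Complex.cos (z * s) + s * Complex.sin (z * s) = N at *
  field_simp
  linear_combination s ^ 2 * h1

/-- The closed form of the exponential generating function of `peakPoly`. -/
noncomputable def peakClosedForm (r s x y z : ℂ) : ℂ :=
  Complex.exp (x * z * (y - 1)) *
    (((r - 1) / (r + 1)) * ((r + Complex.cos (z * s) + s * Complex.sin (z * s)) /
      (r - Complex.cos (z * s) - s * Complex.sin (z * s)))) ^ (x / (2 * r))

/-- The closed form of the exponential generating function of `valleyPoly`. -/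
noncomputable def valleyClosedForm (q s x y z : ℂ) : ℂ :=
  Complex.exp (x * z * (y - 1 / q)) *
    (s / (s * Complex.cos (z * s) - Complex.sin (z * s))) ^ (x / q)

lemma hasDerivAt_exp_mul_mul (x y z : ℂ) :
    HasDerivAt (fun z => Complex.exp (x * z * y)) (Complex.exp (x * z * y) * (x * y)) z := by
  have : HasDerivAt (fun z => x * z * y) (x * y) z :=
    (((hasDerivAt_id z).const_mul x).mul_const y).congr_deriv (by ring)
  exact this.cexp

/-- The base has logarithmic derivative `2 * r * N' / (r ^ 2 - N ^ 2) = 2 * r * s / D = 2 * r *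
solL`, which explains the exponent `x / (2 * r)`. -/
lemma hasDerivAt_peak (hr : r ≠ 0) (hrs : r ^ 2 = s ^ 2 + 1) (x y : ℂ) {z : ℂ}
    (h : IsRegularPoint r s z) :
    HasDerivAt (peakClosedForm r s x y)
      (peakClosedForm r s x y z * (x * (y - 1 + solL s z))) z := by
  have hB0 := Complex.slitPlane_ne_zero h.peak_mem
  have hD : r - Complex.cos (z * s) - s * Complex.sin (z * s) ≠ 0 := fun e => hB0 (by simp [e])
  have hN := hasDerivAt_numer s z
  have hB : HasDerivAt (fun z => ((r - 1) / (r + 1)) *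
      ((r + Complex.cos (z * s) + s * Complex.sin (z * s)) /
        (r - Complex.cos (z * s) - s * Complex.sin (z * s))))
      (((r - 1) / (r + 1)) * ((r + Complex.cos (z * s) + s * Complex.sin (z * s)) /
        (r - Complex.cos (z * s) - s * Complex.sin (z * s))) * (2 * r * solL s z)) z := by
    simp only [add_assoc, sub_sub] at hD ⊢
    refine (((hN.const_add r).div (hN.const_sub r) hD).const_mul ((r - 1) / (r + 1))).congr_deriv ?_
    refine Eq.trans ?_ (mul_assoc _ _ _).symm
    congr 1
    have h2 := denom_sq_add_numer_sq hrs z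
    have h3 := h.denom_ne
    simp only [solL]
    generalize s * Complex.cos (z * s) - Complex.sin (z * s) = D at *
    generalize Complex.cos (z * s) + s * Complex.sin (z * s) = N at *
    field_simp
    linear_combination 2 * r * s * h2
  refine ((hasDerivAt_exp_mul_mul x (y - 1) z).mul (hB.cpow_const h.peak_mem)).congr_deriv ?_
  rw [Complex.cpow_sub _ _ hB0, Complex.cpow_one, peakClosedForm]
  generalize ((r - 1) / (r + 1)) * ((r + Complex.cos (z * s) + s * Complex.sin (z * s)) /
    (r - Complex.cos (z * s) - s * Complex.sin (z * s))) = B at *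
  generalize B ^ (x / (2 * r)) = C
  field_simp

/-- Here the base is `solL`, whose logarithmic derivative is `solT`. -/
lemma hasDerivAt_valley (hr : r ≠ 0) (x y : ℂ) {z : ℂ}
    (h : IsRegularPoint r s z) :
    HasDerivAt (valleyClosedForm (r ^ 2) s x y)
      (valleyClosedForm (r ^ 2) s x y z * (x / r ^ 2 * (solT s z - 1 + r ^ 2 * y))) z := by
  have hL0 := Complex.slitPlane_ne_zero h.valley_mem
  have hL := hasDerivAt_solL h.denom_ne
  refine ((hasDerivAt_exp_mul_mul x (y - 1 / r ^ 2) z).mul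
    (hL.cpow_const h.valley_mem)).congr_deriv ?_
  change _ * (solL s z ^ (x / r ^ 2)) + _ * (x / r ^ 2 * solL s z ^ (x / r ^ 2 - 1) * _) =
    Complex.exp _ * (solL s z ^ (x / r ^ 2)) * _
  have hL0' : solL s z ≠ 0 := hL0
  rw [Complex.cpow_sub _ _ hL0', Complex.cpow_one]
  generalize solL s z ^ (x / r ^ 2) = C
  field_simp
  ring

end closedForm

theorem mainTheorem4 (q : ℂ) (hq0 : q ≠ 0) (hq1 : q ≠ 1) :
    ∃ ρ : ℝ, 0 < ρ ∧
      ∀ r s : ℂ, r ^ 2 = q → s ^ 2 = q - 1 →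
        ∀ x y z : ℂ, ‖z‖ < ρ →
          HasSum (fun n : ℕ => peakPoly n q x y * (z ^ n / (Nat.factorial n : ℂ)))
            (Complex.exp (x * z * (y - 1)) *
              (((r - 1) / (r + 1)) *
                ((r + Complex.cos (z * s) + s * Complex.sin (z * s)) /
                  (r - Complex.cos (z * s) - s * Complex.sin (z * s)))) ^ (x / (2 * r))) ∧
          HasSum (fun n : ℕ => valleyPoly n q x y * (z ^ n / (Nat.factorial n : ℂ)))
            (Complex.exp (x * z * (y - 1 / q)) *
              (s / (s * Complex.cos (z * s) - Complex.sin (z * s))) ^ (x / q)) := by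
  obtain ⟨ρ, hρ, hreg⟩ := exists_radius hq1
  refine ⟨ρ, hρ, fun r s hr hs x y z hz => ?_⟩
  replace hreg := hreg r s hr hs
  subst hr
  have hr : r ≠ 0 := by rintro rfl; simp at hq0
  have hrs : r ^ 2 = s ^ 2 + 1 := by rw [hs]; ring
  have hs0 : s ≠ 0 := by
    rintro rfl
    exact hq1 (by simpa using hrs)
  have hr1 : r - 1 ≠ 0 := fun h => hq1 (by linear_combination (r + 1) * h)
  have hr2 : r + 1 ≠ 0 := fun h => hq1 (by linear_combination (r - 1) * h)
  have h4 : (r - 1) / (r + 1) * ((r + 1) / (r - 1)) = 1 := by field_simp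
  have hL0 : solL s 0 = 1 := by simp [solL, hs0]
  have hT0 : solT s 0 = 1 := by simp [solT, hs0]
  have hW : ∀ z : ℂ, ‖z‖ < ρ →
      HasDerivAt (fun z => r * solL s z) (r * solL s z * solT s z) z := fun z hz =>
    ((hasDerivAt_solL (hreg z hz).denom_ne).const_mul r).congr_deriv (by ring)
  have hL : ∀ z : ℂ, ‖z‖ < ρ → HasDerivAt (solL s) (solL s z * solT s z) z := fun z hz =>
    hasDerivAt_solL (hreg z hz).denom_ne
  have hT : ∀ z : ℂ, ‖z‖ < ρ → HasDerivAt (solT s) ((r * solL s z) ^ 2) z := fun z hz =>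
    hasDerivAt_solT hrs (hreg z hz).denom_ne
  constructor
  -- `Y` and `E = solL` have the same derivative, so they differ by the constant `y - 1`.
  · have h := hasSum_sum_permWeight (b := True) (x := x) (Y := fun z => y - 1 + solL s z)
      (I := peakClosedForm r s x y) (fun z hz => hasDerivAt_peak hr hrs x y (hreg z hz))
      (fun z hz => ((hL z hz).const_add (y - 1)).congr_deriv (by simp)) hL hW hT hz
    have hI : peakClosedForm r s x y 0 = 1 := by simp [peakClosedForm, h4]
    simp only [hI, hL0, hT0, one_mul, mul_one, sub_add_cancel, sum_permWeight_peak] at h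
    exact h
  -- Now `Y' = W ^ 2 = T'`, and the constant makes `Y 0 = r ^ 2 * y`, as `sum_permWeight_valley`
  -- needs.
  · have h := hasSum_sum_permWeight (b := False) (x := x / r ^ 2)
      (Y := fun z => solT s z - 1 + r ^ 2 * y)
      (I := valleyClosedForm (r ^ 2) s x y) (fun z hz => hasDerivAt_valley hr x y (hreg z hz))
      (fun z hz => (((hT z hz).sub_const 1).add_const (r ^ 2 * y)).congr_deriv (by simp))
      hL hW hT hz
    have hI : valleyClosedForm (r ^ 2) s x y 0 = 1 := by simp [valleyClosedForm, hs0]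
    simp only [hI, hL0, hT0, one_mul, mul_one, sub_self, zero_add,
      sum_permWeight_valley _ _ _ hr] at h
    exact h
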